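/- For real numbers $x_1,\dots,x_n$ ($n\ge 1$) and $1<p<\infty$, the $p$-average of $x_1,\dots,x_n$ (under counting measure) is the real number $a$ minimising $c\mapsto\big(\sum_{i=1}^n|x_i-c|^p\big)^{1/p}$ over $c\in\mathbb R$. Consider the data set $\{1,6,11,13,19\}$, whose mean is $10$. (1) Its $6$-average $a$ exists, is unique, and satisfies $(a-1)^5+(a-6)^5+(a-11)^5+(a-13)^5+(a-19)^5=0$; after the substitution $x=y+10$ this says that $a-10$ is a root of the depressed quintic $$P(x)=x^5+376x^3+72x^2+13460x+156 .$$ (2) $P$ is irreducible over $\mathbb Q$, and its resolvent sextic has rational coefficients and no rational root. Here the resolvent sextic of a monic rational quintic with complex roots $x_1,\dots,x_5$ is the monic sextic polynomial whose roots, with multiplicity, are the six conjugates, under permutation of the $x_i$, of $$\theta=x_1^2(x_2x_5+x_3x_4)+x_2^2(x_1x_3+x_4x_5)+x_3^2(x_1x_5+x_2x_4)+x_4^2(x_1x_2+x_3x_5)+x_5^2(x_1x_4+x_2x_3).$$ (3) $P$ is not solvable by radicals over $\mathbb Q$: none of its complex roots lies in the smallest subfield of $\mathbb C$ closed under extraction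 of $n$-th roots ($n\ge1$). In particular the $6$-average $a$ is not expressible by radicals over $\mathbb Q$. (4) Consequently there is no radical formula for the $6$-average in general: no expression in five variables built from rational numbers and the variables with the field operations and $k$-th roots ($k\ge 1$) has, for all real $x_1,\dots,x_5$, the $6$-average of $x_1,\dots,x_5$ among its values, even when each $k$-th root may stand for any complex $k$-th root. By contrast, for every $n\ge1$ there is such an expression in $n$ variables whose value (with the usual real roots, and defined everywhere) is the $4$-average of $x_1,\dots,x_n$, for all real $x_1,\dots,x_n$. -/

import Mathlib

open MeasureTheory Polynomial

/-- `a` is a `p`-average of `φ : X → ℝ` with respect to `ν`: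
the constant `a` minimises the `L^p(X, ν)` distance from `φ` to the real constants. -/
def IsPAverage {X : Type*} [MeasurableSpace X] (p : ENNReal) (ν : Measure X) (φ : X → ℝ)
    (a : ℝ) : Prop :=
  ∀ c : ℝ, eLpNorm (fun y => φ y - a) p ν ≤ eLpNorm (fun y => φ y - c) p ν

/-- `a` is a `p`-average of the finite list of data `x 0, …, x (n - 1)` under counting measure. -/
def IsDataAverage {n : ℕ} (p : ENNReal) (x : Fin n → ℝ) (a : ℝ) : Prop :=
  IsPAverage p Measure.count x a

/-- The data set `{1, 6, 11, 13, 19}`. -/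
def data : Fin 5 → ℝ := ![1, 6, 11, 13, 19]

/-- The depressed quintic `x⁵ + 376 x³ + 72 x² + 13460 x + 156`. -/
noncomputable def quintic : ℚ[X] :=
  X ^ 5 + 376 * X ^ 3 + 72 * X ^ 2 + 13460 * X + 156

/-- The quantity
`θ = x₁²(x₂x₅ + x₃x₄) + x₂²(x₁x₃ + x₄x₅) + x₃²(x₁x₅ + x₂x₄) + x₄²(x₁x₂ + x₃x₅) + x₅²(x₁x₄ + x₂x₃)`,
whose stabiliser in `S₅` is the Frobenius group of order 20
(the indices in `Fin 5` are added modulo 5). -/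
def resolventTheta (x : Fin 5 → ℂ) : ℂ :=
  ∑ i : Fin 5, x i ^ 2 * (x (i + 1) * x (i - 1) + x (i + 2) * x (i - 2))

/-- `R` is the resolvent sextic of the monic rational quintic `f`: its roots (with multiplicity) are
the six conjugates of `θ` under the permutations of the roots of `f`. The permutations fixing the
last two indices form a system of representatives of the six cosets of the stabiliser of `θ`. -/
def IsResolventSextic (f R : ℚ[X]) : Prop :=
  f.Monic ∧ f.natDegree = 5 ∧
    ∀ x : Fin 5 → ℂ, f.map (algebraMap ℚ ℂ) = ∏ i : Fin 5, (X - C (x i)) →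
      R.map (algebraMap ℚ ℂ) =
        ∏ σ ∈ (Finset.univ : Finset (Equiv.Perm (Fin 5))).filter (fun σ => σ 3 = 3 ∧ σ 4 = 4),
          (X - C (resolventTheta (fun i => x (σ i))))

/-- Radical formulas in `n` variables: expressions built from rational numbers and the variables
with the field operations and the extraction of `k`-th roots, `k ≥ 1`. -/
inductive RadicalFormula (n : ℕ) : Type
  | const (q : ℚ) : RadicalFormula n
  | var (i : Fin n) : RadicalFormula n
  | add (F G : RadicalFormula n) : RadicalFormula n
  | neg (F : RadicalFormula n) : RadicalFormula n
  | mul (F G : RadicalFormula n) : RadicalFormula n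
  | inv (F : RadicalFormula n) : RadicalFormula n
  | root (k : ℕ+) (F : RadicalFormula n) : RadicalFormula n

/-- `F.IsValue x z`: the complex number `z` is one of the values of `F` at `x`, where every
occurrence of a `k`-th root may stand for any complex `k`-th root. -/
def RadicalFormula.IsValue {n : ℕ} : RadicalFormula n → (Fin n → ℂ) → ℂ → Prop
  | .const q, _, z => z = (q : ℂ)
  | .var i, x, z => z = x i
  | .add F G, x, z => ∃ u v : ℂ, F.IsValue x u ∧ G.IsValue x v ∧ z = u + v
  | .neg F, x, z => ∃ u : ℂ, F.IsValue x u ∧ z = -u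
  | .mul F G, x, z => ∃ u v : ℂ, F.IsValue x u ∧ G.IsValue x v ∧ z = u * v
  | .inv F, x, z => ∃ u : ℂ, F.IsValue x u ∧ u ≠ 0 ∧ z = u⁻¹
  | .root k F, x, z => ∃ u : ℂ, F.IsValue x u ∧ z ^ (k : ℕ) = u

/-- `F.IsRealValue x z`: the formula `F` is defined at `x` in real arithmetic, with value `z`.
Here roots are the usual real ones: for even `k` the nonnegative `k`-th root of a nonnegative
number, for odd `k` the unique real `k`-th root. -/
def RadicalFormula.IsRealValue {n : ℕ} : RadicalFormula n → (Fin n → ℝ) → ℝ → Prop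
  | .const q, _, z => z = (q : ℝ)
  | .var i, x, z => z = x i
  | .add F G, x, z => ∃ u v : ℝ, F.IsRealValue x u ∧ G.IsRealValue x v ∧ z = u + v
  | .neg F, x, z => ∃ u : ℝ, F.IsRealValue x u ∧ z = -u
  | .mul F G, x, z => ∃ u v : ℝ, F.IsRealValue x u ∧ G.IsRealValue x v ∧ z = u * v
  | .inv F, x, z => ∃ u : ℝ, F.IsRealValue x u ∧ u ≠ 0 ∧ z = u⁻¹
  | .root k F, x, z =>
      ∃ u : ℝ, F.IsRealValue x u ∧ z ^ (k : ℕ) = u ∧ (Even (k : ℕ) → 0 ≤ z)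

/-! For an even exponent `2k` the average is the zero of the derivative, `∑ (a - xᵢ)^(2k-1) = 0`.
For `k = 2` this is a cubic; centred at the mean it is depressed with nonnegative linear
coefficient, so Cardano's formula needs only real roots.

For `k = 3` and the given data it is the quintic `P`. Irreducibility follows from reduction modulo
7. If `P` were solvable, its Galois group, being transitive of prime degree, would act on suitably
labelled roots by affine maps of `ℤ/5` (`exists_equiv_smul_eq_affine`). These fix `θ`, so `θ` would
be a rational root of the resolvent sextic. Modulo 23, however, `P` is an irreducible quadratic
times three distinct linear factors, and every conjugate of `θ` reduces to an element outside the
prime field (`cyclicTheta_ne_intCast_of_charP`). Hence the sextic has no rational root, and `P` is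
not solvable. A general radical formula, evaluated at the integer data, would contradict this. -/

/-! ### Averages with even exponent. -/

theorem eLpNorm_count_even_le_iff {n m : ℕ} (hm : m ≠ 0) (f g : Fin n → ℝ) :
    eLpNorm f (2 * m : ℕ) Measure.count ≤ eLpNorm g (2 * m : ℕ) Measure.count ↔
      ∑ i, f i ^ (2 * m) ≤ ∑ i, g i ^ (2 * m) := by
  have key (f : Fin n → ℝ) : eLpNorm f (2 * m : ℕ) Measure.count =
      (ENNReal.ofReal (∑ i, f i ^ (2 * m))) ^ (1 / ((2 * m : ℕ) : ℝ)) := by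
    rw [eLpNorm_eq_lintegral_rpow_enorm_toReal (by simpa using hm) (ENNReal.natCast_ne_top _),
      lintegral_count, tsum_fintype, ENNReal.toReal_natCast,
      ENNReal.ofReal_sum_of_nonneg fun i _ => (even_two_mul m).pow_nonneg _]
    congr 1
    refine Finset.sum_congr rfl fun i _ => ?_
    rw [ENNReal.rpow_natCast, Real.enorm_eq_ofReal_abs, ← ENNReal.ofReal_pow (abs_nonneg _),
      (even_two_mul m).pow_abs]
  rw [key, key, ENNReal.rpow_le_rpow_iff (by positivity), ENNReal.ofReal_le_ofReal_iff]
  exact Finset.sum_nonneg fun i _ => (even_two_mul m).pow_nonneg _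

theorem isDataAverage_even_iff {n m : ℕ} (hm : m ≠ 0) (x : Fin n → ℝ) (a : ℝ) :
    IsDataAverage (2 * m : ℕ) x a ↔
      ∀ c, ∑ i, (x i - a) ^ (2 * m) ≤ ∑ i, (x i - c) ^ (2 * m) :=
  forall_congr' fun _ => eLpNorm_count_even_le_iff hm _ _

/-- The derivative vanishes at a minimum. Writing the exponent as `2 * (m + 1)` keeps the
derivative's exponent `2 * m + 1` visibly odd; `m = 1` and `m = 2` give the 4- and 6-averages. -/
theorem IsDataAverage.sum_pow_eq_zero {n m : ℕ} {x : Fin n → ℝ} {a : ℝ}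
    (h : IsDataAverage (2 * (m + 1) : ℕ) x a) : ∑ i, (a - x i) ^ (2 * m + 1) = 0 := by
  rw [isDataAverage_even_iff m.succ_ne_zero] at h
  have hmin : IsLocalMin (fun c => ∑ i, (x i - c) ^ (2 * (m + 1))) a :=
    Filter.Eventually.of_forall h
  have hd : HasDerivAt (fun c => ∑ i, (x i - c) ^ (2 * (m + 1)))
      (∑ i, ((2 * (m + 1) : ℕ) : ℝ) * (x i - a) ^ (2 * (m + 1) - 1) * (-1)) a :=
    HasDerivAt.fun_sum fun i _ => ((hasDerivAt_id a).const_sub (x i)).pow (2 * (m + 1))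
  have h0 := hmin.hasDerivAt_eq_zero hd
  have h1 : ∀ i, ((2 * (m + 1) : ℕ) : ℝ) * (x i - a) ^ (2 * (m + 1) - 1) * (-1) =
      ((2 * (m + 1) : ℕ) : ℝ) * (a - x i) ^ (2 * m + 1) := fun i => by
    rw [show 2 * (m + 1) - 1 = 2 * m + 1 by omega, ← neg_sub a (x i), (odd_two_mul_add_one m).neg_pow]
    ring
  rw [Finset.sum_congr rfl fun i _ => h1 i, ← Finset.mul_sum] at h0
  exact (mul_eq_zero.1 h0).resolve_left (by positivity)

/-- Convexity: the graph of the sixth power lies above its tangent at `u`. -/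
theorem pow_six_tangent (u d : ℝ) : u ^ 6 - 6 * u ^ 5 * d ≤ (u - d) ^ 6 := by
  nlinarith [sq_nonneg (d * (d ^ 2 - 3 * u * d + 3 * u ^ 2)), sq_nonneg (d * u * (d - 2 * u)),
    sq_nonneg (d * u ^ 2), sq_nonneg (d * u * d), sq_nonneg (d ^ 3)]

theorem sum_pow_strictMono {n m : ℕ} (hn : 0 < n) (x : Fin n → ℝ) :
    StrictMono fun a : ℝ => ∑ i, (a - x i) ^ (2 * m + 1) := fun _ _ hab =>
  Finset.sum_lt_sum_of_nonempty ⟨⟨0, hn⟩, Finset.mem_univ _⟩ fun i _ =>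
    (odd_two_mul_add_one m).strictMono_pow (sub_lt_sub_right hab (x i))

theorem existsUnique_isDataAverage_six_data : ∃! a : ℝ, IsDataAverage 6 data a := by
  have h6 : (6 : ENNReal) = ((2 * (2 + 1) : ℕ) : ENNReal) := by norm_num
  rw [h6]
  -- All data lie strictly between 0 and 20, so the sum is negative at 0 and positive at 20.
  obtain ⟨a, -, ha⟩ : (0 : ℝ) ∈ (fun a : ℝ => ∑ i, (a - data i) ^ (2 * 2 + 1)) '' Set.Icc 0 20 := by
    refine intermediate_value_Icc (by norm_num) (by fun_prop) ⟨?_, ?_⟩ <;>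
      norm_num [data, Fin.sum_univ_succ]
  refine ⟨a, (isDataAverage_even_iff (by norm_num) _ _).2 fun c => ?_, fun b hb => ?_⟩
  -- Summing the tangent inequalities at a critical point kills the linear terms, so a critical
  -- point is a global minimum.
  · have h1 : ∑ i, ((data i - a) ^ 6 - 6 * (data i - a) ^ 5 * (c - a)) ≤ ∑ i, (data i - c) ^ 6 :=
      Finset.sum_le_sum fun i _ => by
        simpa using pow_six_tangent (data i - a) (c - a)
    have h2 : ∑ i, 6 * (data i - a) ^ 5 * (c - a) = 0 := by
      rw [← Finset.sum_mul, ← Finset.mul_sum]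
      have : ∑ i, (data i - a) ^ 5 = - ∑ i, (a - data i) ^ (2 * 2 + 1) := by
        rw [← Finset.sum_neg_distrib]
        exact Finset.sum_congr rfl fun i _ => by ring
      rw [this]
      simp only at ha
      rw [ha]; ring
    rw [Finset.sum_sub_distrib, h2, sub_zero] at h1
    exact h1
  · exact (sum_pow_strictMono (m := 2) (by norm_num) data).injective (hb.sum_pow_eq_zero.trans ha.symm)

theorem IsDataAverage.six_data {a : ℝ} (h : IsDataAverage 6 data a) :
    (a - 1) ^ 5 + (a - 6) ^ 5 + (a - 11) ^ 5 + (a - 13) ^ 5 + (a - 19) ^ 5 = 0 ∧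
      aeval (a - 10) quintic = 0 := by
  have h6 : (6 : ENNReal) = ((2 * (2 + 1) : ℕ) : ENNReal) := by norm_num
  rw [h6] at h
  have h1 : (a - 1) ^ 5 + (a - 6) ^ 5 + (a - 11) ^ 5 + (a - 13) ^ 5 + (a - 19) ^ 5 = 0 := by
    simpa [data, Fin.sum_univ_succ, add_assoc] using h.sum_pow_eq_zero
  refine ⟨h1, ?_⟩
  simp only [quintic, map_add, map_mul, map_pow, aeval_X, map_ofNat]
  linear_combination h1 / 5

/-! ### Radical formulas and the 4-average. -/

namespace RadicalFormula

/-- The sum of a family of formulas. -/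
def sum {n m : ℕ} (F : Fin m → RadicalFormula n) : RadicalFormula n :=
  (List.ofFn F).foldr add (const 0)

theorem isRealValue_sum {n m : ℕ} {x : Fin n → ℝ} {F : Fin m → RadicalFormula n} {v : Fin m → ℝ}
    (h : ∀ i, (F i).IsRealValue x (v i)) : (sum F).IsRealValue x (∑ i, v i) := by
  unfold sum
  induction m with
  | zero => simp [IsRealValue]
  | succ m ih =>
    rw [List.ofFn_succ, List.foldr_cons, Fin.sum_univ_succ]
    exact ⟨_, _, h 0, ih fun i => h i.succ, rfl⟩

/-- The arithmetic mean of a family of formulas. -/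
def mean {n m : ℕ} (F : Fin m → RadicalFormula n) : RadicalFormula n :=
  mul (const (m : ℚ)⁻¹) (sum F)

theorem isRealValue_mean {n m : ℕ} {x : Fin n → ℝ} {F : Fin m → RadicalFormula n} {v : Fin m → ℝ}
    (h : ∀ i, (F i).IsRealValue x (v i)) : (mean F).IsRealValue x ((m : ℝ)⁻¹ * ∑ i, v i) :=
  ⟨_, _, rfl, isRealValue_sum h, by simp⟩

/-- The deviation of the `i`-th variable from the mean of all variables. -/
def deviation {n : ℕ} (i : Fin n) : RadicalFormula n := add (var i) (neg (mean var))

/-- Cardano's expression for the real root of `y ^ 3 + 3 * v * y - 2 * w`. -/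
def cardano {n : ℕ} (v w : RadicalFormula n) : RadicalFormula n :=
  let D := root 2 (add (mul w w) (mul v (mul v v)))
  add (root 3 (add w D)) (root 3 (add w (neg D)))

/-- Since `v ≥ 0`, the radicand `w² + v³` is nonnegative and the cubic has a single real root, so
the usual real radicals produce exactly `y`. -/
theorem isRealValue_cardano {n : ℕ} {x : Fin n → ℝ} {F G : RadicalFormula n} {v w y : ℝ}
    (hF : F.IsRealValue x v) (hG : G.IsRealValue x w) (hv : 0 ≤ v)
    (hy : y ^ 3 + 3 * v * y - 2 * w = 0) : (cardano F G).IsRealValue x y := by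
  have hcube : Function.Surjective fun t : ℝ => t ^ 3 :=
    fun t => mem_range_of_exists_le_of_exists_ge (continuous_pow 3)
      ⟨-(1 + |t|), by nlinarith [neg_abs_le t, abs_nonneg t, pow_nonneg (abs_nonneg t) 3]⟩
      ⟨1 + |t|, by nlinarith [le_abs_self t, abs_nonneg t, pow_nonneg (abs_nonneg t) 3]⟩
  have hinj : Function.Injective fun t : ℝ => t ^ 3 := (by decide : Odd 3).strictMono_pow.injective
  set D := √(w * w + v * (v * v)) with hD
  have hD2 : D ^ 2 = w * w + v * (v * v) := Real.sq_sqrt (by nlinarith [mul_self_nonneg w, pow_nonneg hv 3])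
  obtain ⟨A, hA⟩ := hcube (w + D)
  obtain ⟨B, hB⟩ := hcube (w + -D)
  simp only at hA hB
  -- `(A * B)³ = w² - D² = (-v)³`, and cubing is injective on the reals.
  have hAB : A * B = -v := hinj <| by
    simp only
    rw [mul_pow, hA, hB]
    linear_combination -hD2
  have hroot : (A + B) ^ 3 + 3 * v * (A + B) - 2 * w = 0 := by
    linear_combination hA + hB + 3 * (A + B) * hAB
  have hyAB : y = A + B := by
    have h : (y - (A + B)) * (y ^ 2 + y * (A + B) + (A + B) ^ 2 + 3 * v) = 0 := by
      linear_combination hy - hroot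
    rcases mul_eq_zero.1 h with h | h
    · linarith
    -- A sum of the nonnegative terms `y² + y(A+B) + (A+B)²` and `3v` vanishes, which forces `y = A
    -- + B = 0`.
    · have h1 : y ^ 2 + y * (A + B) + (A + B) ^ 2 = 0 := by
        nlinarith [sq_nonneg (y + (A + B) / 2), sq_nonneg (A + B)]
      have h2 : (A + B) ^ 2 = 0 := by nlinarith [sq_nonneg (y + (A + B) / 2), sq_nonneg (A + B)]
      have h3 : y ^ 2 = 0 := by nlinarith [sq_nonneg (y + (A + B) / 2), sq_nonneg (y / 2 + (A + B))]
      rw [pow_eq_zero_iff two_ne_zero] at h2 h3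
      rw [h2, h3]
  have hDv : (root 2 (add (mul G G) (mul F (mul F F)))).IsRealValue x D :=
    ⟨_, ⟨_, _, ⟨_, _, hG, hG, rfl⟩, ⟨_, _, hF, ⟨_, _, hF, hF, rfl⟩, rfl⟩, rfl⟩, hD2,
      fun _ => Real.sqrt_nonneg _⟩
  exact ⟨A, B, ⟨_, ⟨_, _, hG, hDv, rfl⟩, hA, fun h => absurd h (by decide)⟩,
    ⟨_, ⟨_, _, hG, ⟨_, hDv, rfl⟩, rfl⟩, hB, fun h => absurd h (by decide)⟩, hyAB⟩

/-- A radical formula for the `4`-average. -/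
def fourAverage (n : ℕ) : RadicalFormula n :=
  add (mean var) (cardano
    (mean fun i : Fin n => mul (deviation i) (deviation i))
    (mul (const (1 / 2))
      (mean fun i : Fin n => mul (deviation i) (mul (deviation i) (deviation i)))))

theorem isRealValue_fourAverage {n : ℕ} (hn : 0 < n) {x : Fin n → ℝ} {a : ℝ}
    (h : IsDataAverage 4 x a) : (fourAverage n).IsRealValue x a := by
  have h4 : (4 : ENNReal) = ((2 * (1 + 1) : ℕ) : ENNReal) := by norm_num
  rw [h4] at h
  have hn0 : (n : ℝ) ≠ 0 := by positivity
  have h3 : ∑ i, (a - x i) ^ 3 = 0 := h.sum_pow_eq_zero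
  set m : ℝ := (n : ℝ)⁻¹ * ∑ i, x i with hm
  have hmean : (mean var).IsRealValue x m := isRealValue_mean fun i => rfl
  have hdev (i : Fin n) : (deviation i).IsRealValue x (x i + -m) := ⟨_, _, rfl, ⟨_, hmean, rfl⟩, rfl⟩
  have hsum : ∑ i, (x i + -m) = 0 := by
    rw [Finset.sum_add_distrib, Finset.sum_const, Finset.card_univ, Fintype.card_fin, nsmul_eq_mul,
      hm]
    field_simp
    ring
  refine ⟨m, a - m, hmean, isRealValue_cardano
    (isRealValue_mean fun i => ⟨_, _, hdev i, hdev i, rfl⟩)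
    ⟨_, _, rfl, isRealValue_mean fun i => ⟨_, _, hdev i, ⟨_, _, hdev i, hdev i, rfl⟩, rfl⟩, rfl⟩
    (mul_nonneg (by positivity) (Finset.sum_nonneg fun i _ => mul_self_nonneg _)) ?_, by ring⟩
  -- With deviations `dᵢ = xᵢ - m`, whose sum is 0, dividing by `n` leaves `y³ + 3vy - 2w = 0` for
  -- `y = a - m`, where `v` is the mean of `dᵢ²` and `2w` the mean of `dᵢ³`.
  have hexp : ∑ i, (a - x i) ^ 3 = n * (a - m) ^ 3 - 3 * (a - m) ^ 2 * ∑ i, (x i + -m) +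
      3 * (a - m) * ∑ i, (x i + -m) * (x i + -m) -
        ∑ i, (x i + -m) * ((x i + -m) * (x i + -m)) := by
    have : (n : ℝ) * (a - m) ^ 3 = ∑ _i : Fin n, (a - m) ^ 3 := by simp
    rw [this, Finset.mul_sum, Finset.mul_sum, ← Finset.sum_sub_distrib, ← Finset.sum_add_distrib,
      ← Finset.sum_sub_distrib]
    exact Finset.sum_congr rfl fun i _ => by ring
  rw [h3, hsum] at hexp
  have hn1 : (n : ℝ) * (n : ℝ)⁻¹ = 1 := mul_inv_cancel₀ hn0
  push_cast
  linear_combination -(n : ℝ)⁻¹ * hexp - (a - m) ^ 3 * hn1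

theorem IsValue.mem_solvableByRad {n : ℕ} {x : Fin n → ℂ} (hx : ∀ i, x i ∈ solvableByRad ℚ ℂ)
    {F : RadicalFormula n} {z : ℂ} (h : F.IsValue x z) : z ∈ solvableByRad ℚ ℂ := by
  induction F generalizing z with
  | const q => rw [show z = algebraMap ℚ ℂ q from h]; exact algebraMap_mem _ _
  | var i => rw [show z = x i from h]; exact hx i
  | add F G hF hG => obtain ⟨u, v, hu, hv, rfl⟩ := h; exact add_mem (hF hu) (hG hv)
  | neg F hF => obtain ⟨u, hu, rfl⟩ := h; exact neg_mem (hF hu)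
  | mul F G hF hG => obtain ⟨u, v, hu, hv, rfl⟩ := h; exact mul_mem (hF hu) (hG hv)
  | inv F hF => obtain ⟨u, hu, -, rfl⟩ := h; exact inv_mem (hF hu)
  | root k F hF => obtain ⟨u, hu, rfl⟩ := h; exact solvableByRad.rad_mem k.ne_zero (hF hu)

end RadicalFormula

/-! ### Irreducibility of the quintic, by reduction modulo 7. -/

noncomputable def quinticInt : ℤ[X] :=
  X ^ 5 + C 376 * X ^ 3 + C 72 * X ^ 2 + C 13460 * X + C 156

theorem quinticInt_map {K : Type*} [CommRing K] : quinticInt.map (Int.castRingHom K) =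
    X ^ 5 + 376 * X ^ 3 + 72 * X ^ 2 + 13460 * X + 156 := by
  simp [quinticInt]

theorem quinticInt_natDegree : quinticInt.natDegree = 5 := by
  unfold quinticInt; compute_degree!

theorem quinticInt_monic : quinticInt.Monic := by
  unfold quinticInt; monicity!

theorem quinticInt_map_rat : quinticInt.map (Int.castRingHom ℚ) = quintic := quinticInt_map

theorem quintic_monic : quintic.Monic := quinticInt_map_rat ▸ quinticInt_monic.map _

theorem quintic_natDegree : quintic.natDegree = 5 := by
  rw [← quinticInt_map_rat, quinticInt_monic.natDegree_map, quinticInt_natDegree]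

theorem zmod_seven_quintic_ne_zero :
    ∀ r : ZMod 7, r ^ 5 + 376 * r ^ 3 + 72 * r ^ 2 + 13460 * r + 156 ≠ 0 := by decide

/-- The two expressions are the coefficients of the remainder of the quintic on division by `X² + uX
+ v`. -/
theorem zmod_seven_remainder_ne_zero : ∀ u v : ZMod 7,
    u ^ 4 - 3 * u ^ 2 * v + v ^ 2 + 376 * (u ^ 2 - v) - 72 * u + 13460 = 0 →
      u ^ 3 * v - 2 * u * v ^ 2 + 376 * u * v - 72 * v + 156 ≠ 0 := by decide

theorem quinticInt_map_zmod_seven_irreducible :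
    Irreducible (quinticInt.map (Int.castRingHom (ZMod 7))) := by
  have : Fact (Nat.Prime 7) := ⟨by norm_num⟩
  have hm := quinticInt_monic.map (Int.castRingHom (ZMod 7))
  have hd : (quinticInt.map (Int.castRingHom (ZMod 7))).natDegree = 5 := by
    rw [quinticInt_monic.natDegree_map, quinticInt_natDegree]
  rw [hm.irreducible_iff_lt_natDegree_lt (by intro h; simp [h] at hd), hd]
  intro q hq hdeg hdvd
  rw [quinticInt_map] at hdvd
  rw [Finset.mem_Ioc] at hdeg
  obtain h | h : q.natDegree = 1 ∨ q.natDegree = 2 := by omega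
  · rw [hq.eq_X_add_C h, ← sub_neg_eq_add, ← C_neg, dvd_iff_isRoot] at hdvd
    generalize -q.coeff 0 = r at hdvd
    simp at hdvd
    exact zmod_seven_quintic_ne_zero r hdvd
  · obtain ⟨u, v, rfl⟩ : ∃ u v : ZMod 7, q = X ^ 2 + C u * X + C v := by
      refine ⟨q.coeff 1, q.coeff 0, ?_⟩
      conv_lhs => rw [hq.as_sum, h]
      simp [Finset.sum_range_succ]; ring
    have hq2 : (X ^ 2 + C u * X + C v) ∣
        C (u ^ 4 - 3 * u ^ 2 * v + v ^ 2 + 376 * (u ^ 2 - v) - 72 * u + 13460) * X +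
          C (u ^ 3 * v - 2 * u * v ^ 2 + 376 * u * v - 72 * v + 156) := by
      -- The cubic is the quotient in the division of the quintic by `X² + uX + v`.
      have := dvd_sub hdvd (dvd_mul_right (X ^ 2 + C u * X + C v) (X ^ 3 - C u * X ^ 2 +
        C (376 + u ^ 2 - v) * X + C (72 - u * (376 + u ^ 2 - v) + u * v)))
      convert this using 1
      simp only [C_add, C_sub, C_mul, C_pow, map_ofNat]
      ring
    have h0 := eq_zero_of_dvd_of_natDegree_lt hq2
      (by rw [h]; exact natDegree_linear_le.trans_lt one_lt_two)
    have h1 := congrArg (coeff · 1) h0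
    have h2 := congrArg (coeff · 0) h0
    simp only [coeff_add, coeff_C_mul, coeff_X_one, coeff_X_zero, coeff_C_zero,
      coeff_zero, mul_one, mul_zero, add_zero, zero_add, coeff_C_of_ne_zero one_ne_zero] at h1 h2
    exact zmod_seven_remainder_ne_zero u v h1 h2

theorem quintic_irreducible : Irreducible quintic := by
  have : Fact (Nat.Prime 7) := ⟨by norm_num⟩
  have : Irreducible quinticInt := quinticInt_monic.irreducible_of_irreducible_map
    (Int.castRingHom (ZMod 7)) _ quinticInt_map_zmod_seven_irreducible
  rw [← quinticInt_map_rat]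
  exact (quinticInt_monic.irreducible_iff_irreducible_map_fraction_map (K := ℚ)).1 this

/-! ### Solvable transitive groups of prime degree. -/

open scoped commutatorElement in
-- The last nontrivial term of the derived series serves as `N`.
theorem Group.IsSolvable.exists_normal_isMulCommutative {G : Type*} [Group G] [Nontrivial G]
    (h : Group.IsSolvable G) : ∃ N : Subgroup G, N.Normal ∧ N ≠ ⊥ ∧ ∀ a ∈ N, ∀ b ∈ N, a * b = b * a := by
  classical
  have hex : ∃ n, derivedSeries G n = ⊥ := h.solvable
  obtain ⟨m, hm⟩ : ∃ m, Nat.find hex = m + 1 := by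
    refine Nat.exists_eq_succ_of_ne_zero fun h0 => ?_
    have := Nat.find_spec hex
    rw [h0, derivedSeries_zero] at this
    exact top_ne_bot this
  have hspec := Nat.find_spec hex
  rw [hm, derivedSeries_succ] at hspec
  refine ⟨derivedSeries G m, inferInstance, Nat.find_min hex (by omega), fun a ha b hb => ?_⟩
  have : ⁅a, b⁆ = 1 := by
    rw [← Subgroup.mem_bot, ← hspec]
    exact Subgroup.commutator_mem_commutator ha hb
  exact commutatorElement_eq_one_iff_mul_comm.1 this

/-- A solvable transitive permutation group of prime degree acts by affine maps. -/
theorem exists_equiv_smul_eq_affine {G X : Type*} [Group G] [Finite G] [MulAction G X]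
    [FaithfulSMul G X] [MulAction.IsPretransitive G X] {p : ℕ} [hp : Fact p.Prime]
    (hX : Nat.card X = p) (hG : Group.IsSolvable G) :
    ∃ e : ZMod p ≃ X, ∀ g : G, ∃ a b : ZMod p, ∀ i, g • e i = e (a * i + b) := by
  have : Finite X := Nat.finite_of_card_ne_zero (hX ▸ hp.out.ne_zero)
  have hX1 : 1 < Nat.card X := hX ▸ hp.out.one_lt
  have : Nontrivial X := Finite.one_lt_card_iff_nontrivial.1 hX1
  have : Nontrivial G := by
    obtain ⟨x, y, hxy⟩ := exists_pair_ne X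
    obtain ⟨g, hg⟩ := MulAction.exists_smul_eq G x y
    exact ⟨g, 1, fun h => hxy (by rw [← hg, h, one_smul])⟩
  obtain ⟨N, hN, hN1, hcomm⟩ := hG.exists_normal_isMulCommutative
  have : MulAction.IsPreprimitive G X := MulAction.IsPreprimitive.of_prime_card (hX ▸ hp.out)
  -- Prime degree makes the action primitive, so a nontrivial normal subgroup is transitive; its
  -- order is then divisible by `p`, and Cauchy's theorem yields `c`.
  have hNt : MulAction.IsPretransitive N X :=
    MulAction.IsQuasiPreprimitive.isPretransitive_of_normal (G := G) fun h => hN1 <| by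
      rw [Subgroup.eq_bot_iff_forall]
      intro g hg
      refine FaithfulSMul.eq_of_smul_eq_smul (α := X) fun x => ?_
      have hx : x ∈ MulAction.fixedPoints N X := h ▸ Set.mem_univ x
      simpa using hx ⟨g, hg⟩
  obtain ⟨x₀⟩ : Nonempty X := inferInstance
  have hdvd : p ∣ Nat.card N := by
    rw [← hX, ← MulAction.index_stabilizer_of_transitive N x₀]
    exact Subgroup.index_dvd_card _
  obtain ⟨⟨c, hcN⟩, hc⟩ := exists_prime_orderOf_dvd_card' p hdvd
  rw [Subgroup.orderOf_mk] at hc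
  obtain ⟨x, hx⟩ : ∃ x : X, c • x ≠ x := by
    by_contra! h
    have : c = 1 := FaithfulSMul.eq_of_smul_eq_smul (α := X) fun x => by rw [h, one_smul]
    rw [this, orderOf_one] at hc
    exact hp.out.one_lt.ne hc
  -- The orbit of `x` under `c` has `p` points, hence is all of `X`, and `c` becomes the translation
  -- by 1.
  let e : ZMod p → X := fun i => c ^ i.val • x
  have he (n : ℕ) : c ^ n • x = e n := by
    simp only [e, ZMod.val_natCast]
    rw [← hc, pow_mod_orderOf]
  have hadd (n : ℕ) (i : ZMod p) : c ^ n • e i = e (i + n) := by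
    rw [← ZMod.natCast_zmod_val i, ← he, ← mul_smul, ← pow_add, he]
    push_cast
    rw [add_comm]
  have he0 : e 0 = x := by simp [e]
  have hper : MulAction.period c x = p := by
    refine (Nat.dvd_prime hp.out).1 (MulAction.period_dvd_orderOf c x |>.trans hc.dvd)
      |>.resolve_left fun h => hx ?_
    rwa [MulAction.period_eq_one_iff] at h
  have hinj : Function.Injective e := by
    intro i j hij
    have h := congrArg (c ^ (-i).val • ·) hij
    simp only [hadd, ZMod.natCast_zmod_val, add_neg_cancel, he0] at h
    have h1 : p ∣ (j + -i).val := by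
      refine hper.symm.dvd.trans (MulAction.pow_smul_eq_iff_period_dvd.1 ?_)
      exact h.symm
    have h2 := Nat.eq_zero_of_dvd_of_lt h1 (ZMod.val_lt _)
    rw [ZMod.val_eq_zero, ← sub_eq_add_neg, sub_eq_zero] at h2
    exact h2.symm
  have hbij : Function.Bijective e :=
    hinj.bijective_of_nat_card_le (by rw [hX, Nat.card_zmod])
  refine ⟨Equiv.ofBijective e hbij, fun g => ?_⟩
  obtain ⟨b, hb⟩ := hbij.2 (g • x)
  obtain ⟨a, ha⟩ := hbij.2 ((g * c * g⁻¹) • x)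
  -- The conjugate `g * c * g⁻¹` lies in the commutative group `N`, so it commutes with `c` and acts
  -- as a translation by some `a`. Then `g • e i = (g * c * g⁻¹)^i • (g • x)` is affine in `i`.
  have hcom (n : ℕ) : g * c * g⁻¹ * c ^ n = c ^ n * (g * c * g⁻¹) :=
    hcomm _ (hN.conj_mem c hcN g) _ (pow_mem hcN n)
  have hconj (i : ZMod p) : (g * c * g⁻¹) • e i = e (a + i) := by
    rw [← ZMod.natCast_zmod_val i, ← he, ← mul_smul, hcom, mul_smul, ← ha, hadd]
  have hpow (n : ℕ) : (g * c * g⁻¹) ^ n • e b = e (a * n + b) := by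
    induction n with
    | zero => simp
    | succ n ih => rw [pow_succ', mul_smul, ih, hconj]; push_cast; ring_nf
  refine ⟨a, b, fun i => ?_⟩
  have : g * c ^ i.val = (g * c * g⁻¹) ^ i.val * g := by rw [conj_pow]; group
  simp only [Equiv.ofBijective_apply]
  calc g • e i = (g * c ^ i.val) • x := by rw [mul_smul, he, ZMod.natCast_zmod_val]
    _ = e (a * i + b) := by rw [this, mul_smul, ← hb, hpow, ZMod.natCast_zmod_val]

/-! ### The quantity `θ` and the symmetry of its sextic. -/

/-- `resolventTheta` over an arbitrary commutative ring. -/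
def cyclicTheta {K : Type*} [CommRing K] (x : Fin 5 → K) : K :=
  ∑ i : Fin 5, x i ^ 2 * (x (i + 1) * x (i - 1) + x (i + 2) * x (i - 2))

theorem cyclicTheta_eq {K : Type*} [CommRing K] (x : Fin 5 → K) : cyclicTheta x =
    x 0 ^ 2 * (x 1 * x 4 + x 2 * x 3) + x 1 ^ 2 * (x 2 * x 0 + x 3 * x 4) +
      x 2 ^ 2 * (x 3 * x 1 + x 4 * x 0) + x 3 ^ 2 * (x 4 * x 2 + x 0 * x 1) +
        x 4 ^ 2 * (x 0 * x 3 + x 1 * x 2) := by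
  rw [cyclicTheta, Fin.sum_univ_five]
  rfl

theorem map_cyclicTheta {K L : Type*} [CommRing K] [CommRing L] (f : K →+* L) (x : Fin 5 → K) :
    f (cyclicTheta x) = cyclicTheta fun i => f (x i) := by
  simp [cyclicTheta]

theorem cyclicTheta_affine {K : Type*} [CommRing K] (x : Fin 5 → K) {a : Fin 5} (ha : a ≠ 0)
    (b : Fin 5) : cyclicTheta (fun i => x (a * i + b)) = cyclicTheta x := by
  rw [cyclicTheta_eq, cyclicTheta_eq]
  fin_cases a
  · exact absurd rfl ha
  all_goals fin_cases b <;> simp <;> ring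

/-- The product of `X - θ` over the six conjugates of `θ`. -/
noncomputable def sexticProd {K : Type*} [CommRing K] (x : Fin 5 → K) : K[X] :=
  ∏ σ ∈ (Finset.univ : Finset (Equiv.Perm (Fin 5))).filter (fun σ => σ 3 = 3 ∧ σ 4 = 4),
    (X - C (cyclicTheta fun i => x (σ i)))

theorem filter_fix_three_four : (Finset.univ : Finset (Equiv.Perm (Fin 5))).filter
    (fun σ => σ 3 = 3 ∧ σ 4 = 4) = {1, Equiv.swap 0 1, Equiv.swap 0 2, Equiv.swap 1 2,
      Equiv.swap 0 1 * Equiv.swap 1 2, Equiv.swap 1 2 * Equiv.swap 0 1} := by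
  decide

theorem sexticProd_eq {K : Type*} [CommRing K] (x : Fin 5 → K) : sexticProd x =
    (X - C (cyclicTheta ![x 0, x 1, x 2, x 3, x 4])) *
    (X - C (cyclicTheta ![x 1, x 0, x 2, x 3, x 4])) *
    (X - C (cyclicTheta ![x 2, x 1, x 0, x 3, x 4])) *
    (X - C (cyclicTheta ![x 0, x 2, x 1, x 3, x 4])) *
    (X - C (cyclicTheta ![x 1, x 2, x 0, x 3, x 4])) *
    (X - C (cyclicTheta ![x 2, x 0, x 1, x 3, x 4])) := by
  have e (σ : Equiv.Perm (Fin 5)) : (fun i => x (σ i)) =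
      ![x (σ 0), x (σ 1), x (σ 2), x (σ 3), x (σ 4)] := by
    ext i; fin_cases i <;> rfl
  rw [sexticProd, filter_fix_three_four, Finset.prod_insert (by decide), Finset.prod_insert (by decide),
    Finset.prod_insert (by decide), Finset.prod_insert (by decide), Finset.prod_insert (by decide),
    Finset.prod_singleton]
  simp only [e, mul_assoc]
  rfl

/-- A rotation permutes the six conjugates. Each rotated list no longer ends in `x 3, x 4`; an
affine reindexing, which fixes `θ`, brings it back to one of the representatives. -/
theorem sexticProd_comp_finRotate {K : Type*} [CommRing K] (x : Fin 5 → K) :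
    sexticProd (fun i => x (finRotate 5 i)) = sexticProd x := by
  rw [sexticProd_eq, sexticProd_eq]
  rw [show finRotate 5 0 = 1 from by decide]
  rw [show finRotate 5 1 = 2 from by decide]
  rw [show finRotate 5 2 = 3 from by decide]
  rw [show finRotate 5 3 = 4 from by decide]
  rw [show finRotate 5 4 = 0 from by decide]
  rw [show cyclicTheta ![x 1, x 2, x 3, x 4, x 0] = cyclicTheta ![x 0, x 1, x 2, x 3, x 4] by
    simp [cyclicTheta_eq]; ring]
  rw [show cyclicTheta ![x 2, x 1, x 3, x 4, x 0] = cyclicTheta ![x 0, x 2, x 1, x 3, x 4] by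
    simp [cyclicTheta_eq]; ring]
  rw [show cyclicTheta ![x 3, x 2, x 1, x 4, x 0] = cyclicTheta ![x 2, x 0, x 1, x 3, x 4] by
    simp [cyclicTheta_eq]; ring]
  rw [show cyclicTheta ![x 1, x 3, x 2, x 4, x 0] = cyclicTheta ![x 1, x 2, x 0, x 3, x 4] by
    simp [cyclicTheta_eq]; ring]
  rw [show cyclicTheta ![x 2, x 3, x 1, x 4, x 0] = cyclicTheta ![x 2, x 1, x 0, x 3, x 4] by
    simp [cyclicTheta_eq]; ring]
  rw [show cyclicTheta ![x 3, x 1, x 2, x 4, x 0] = cyclicTheta ![x 1, x 0, x 2, x 3, x 4] by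
    simp [cyclicTheta_eq]; ring]
  ring

theorem sexticProd_comp_swap {K : Type*} [CommRing K] (x : Fin 5 → K) :
    sexticProd (fun i => x (Equiv.swap (0 : Fin 5) 1 i)) = sexticProd x := by
  rw [sexticProd_eq, sexticProd_eq]
  rw [show Equiv.swap (0 : Fin 5) 1 0 = 1 from by decide]
  rw [show Equiv.swap (0 : Fin 5) 1 1 = 0 from by decide]
  rw [show Equiv.swap (0 : Fin 5) 1 2 = 2 from by decide]
  rw [show Equiv.swap (0 : Fin 5) 1 3 = 3 from by decide]
  rw [show Equiv.swap (0 : Fin 5) 1 4 = 4 from by decide]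
  ring

/-- A 5-cycle and an adjacent transposition generate `S₅`. -/
theorem sexticProd_comp_perm {K : Type*} [CommRing K] (x : Fin 5 → K) (τ : Equiv.Perm (Fin 5)) :
    sexticProd (fun i => x (τ i)) = sexticProd x := by
  have hτ : τ ∈ Subgroup.closure {finRotate 5, Equiv.swap (0 : Fin 5) (finRotate 5 0)} := by
    rw [Equiv.Perm.closure_cycle_adjacent_swap isCycle_finRotate support_finRotate]
    trivial
  induction hτ using Subgroup.closure_induction generalizing x with
  | mem τ h =>
    obtain rfl | rfl := h
    · exact sexticProd_comp_finRotate x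
    · exact sexticProd_comp_swap x
  | one => rfl
  | mul σ τ _ _ hσ hτ => exact (hτ fun i => x (σ i)).trans (hσ x)
  | inv τ _ hτ =>
    rw [← hτ fun i => x (τ⁻¹ i)]
    simp

theorem map_sexticProd {K L : Type*} [CommRing K] [CommRing L] (f : K →+* L) (x : Fin 5 → K) :
    (sexticProd x).map f = sexticProd fun i => f (x i) := by
  simp only [sexticProd, Polynomial.map_prod, Polynomial.map_sub, map_X, map_C, map_cyclicTheta f]

/-! ### The sextic has no rational root, by reduction modulo 23. -/

theorem exists_perm_of_prod_X_sub_C_eq {K : Type*} [CommRing K] [IsDomain K] {ι : Type*} [Fintype ι]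
    {x y : ι → K} (h : ∏ i, (X - C (x i)) = ∏ i, (X - C (y i))) :
    ∃ τ : Equiv.Perm ι, ∀ i, x (τ i) = y i := by
  classical
  have hroots (z : ι → K) : (∏ i, (X - C (z i))).roots = Finset.univ.val.map z := by
    rw [← roots_multiset_prod_X_sub_C (Finset.univ.val.map z), Multiset.map_map]
    rfl
  have hcard (c : K) : Fintype.card {i // y i = c} = Fintype.card {i // x i = c} := by
    have h1 := congrArg (Multiset.count c) (congrArg roots h)
    rw [hroots, hroots, Multiset.count_map, Multiset.count_map] at h1
    rw [Fintype.card_subtype, Fintype.card_subtype]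
    simpa only [Finset.card_def, Finset.filter_val, eq_comm (a := c)] using h1.symm
  exact ⟨Equiv.ofFiberEquiv fun c => Fintype.equivOfCardEq (hcard c),
    Equiv.ofFiberEquiv_map _⟩

theorem exists_eq_prod_X_sub_C {K : Type*} [Field K] {f : K[X]} (hf : f.Splits) (hm : f.Monic)
    {n : ℕ} (hn : f.natDegree = n) : ∃ x : Fin n → K, f = ∏ i, (X - C (x i)) := by
  obtain rfl : f.roots.toList.length = n := by
    rw [Multiset.length_toList, ← hf.natDegree_eq_card_roots, hn]
  refine ⟨f.roots.toList.get, ?_⟩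
  conv_lhs => rw [hf.eq_prod_roots_of_monic hm, ← Multiset.coe_toList f.roots]
  rw [Multiset.map_coe, Multiset.prod_coe, ← List.prod_ofFn, ← List.ofFn_get f.roots.toList]
  simp [List.map_ofFn, Function.comp_def]

theorem perm_fix_three_four {σ : Equiv.Perm (Fin 5)} (h3 : σ 3 = 3) (h4 : σ 4 = 4) :
    (σ 0 = 0 ∧ σ 1 = 1 ∧ σ 2 = 2) ∨ (σ 0 = 1 ∧ σ 1 = 0 ∧ σ 2 = 2) ∨
    (σ 0 = 2 ∧ σ 1 = 1 ∧ σ 2 = 0) ∨ (σ 0 = 0 ∧ σ 1 = 2 ∧ σ 2 = 1) ∨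
    (σ 0 = 1 ∧ σ 1 = 2 ∧ σ 2 = 0) ∨ (σ 0 = 2 ∧ σ 1 = 0 ∧ σ 2 = 1) := by
  have h : σ ∈ (Finset.univ : Finset (Equiv.Perm (Fin 5))).filter (fun σ => σ 3 = 3 ∧ σ 4 = 4) :=
    Finset.mem_filter.2 ⟨Finset.mem_univ σ, h3, h4⟩
  rw [filter_fix_three_four] at h
  simp only [Finset.mem_insert, Finset.mem_singleton] at h
  obtain rfl | rfl | rfl | rfl | rfl | rfl := h <;> decide

/-- The five values are the roots of the quintic modulo 23. Reduced by the quadratic relation, each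
conjugate of `θ` is `s + tα` with integers `s` and `t ≡ ±8`. If it were an integer `m`, then `α =
t⁻¹(m - s)` would lie in the prime field, where the quadratic has no root. The factors 3 and 20 are
the inverses of 8 and -8 modulo 23. -/
theorem cyclicTheta_ne_intCast_of_charP {k : Type*} [Field k] [CharP k 23] {α : k}
    (hα : α ^ 2 + 8 * α + 19 = 0) {σ : Equiv.Perm (Fin 5)} (h3 : σ 3 = 3) (h4 : σ 4 = 4) (m : ℤ) :
    (m : k) ≠ cyclicTheta fun i => ![α, -8 - α, 6, 12, 13] (σ i) := by
  have h23 : (23 : k) = 0 := CharP.cast_eq_zero k 23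
  have hirr : ∀ n : ℤ, (n : k) ≠ α := by
    rintro n rfl
    have h1 : ((n ^ 2 + 8 * n + 19 : ℤ) : k) = 0 := by push_cast; exact hα
    rw [CharP.intCast_eq_zero_iff k 23, ← Nat.cast_ofNat,
      ← ZMod.intCast_zmod_eq_zero_iff_dvd] at h1
    push_cast at h1
    generalize (n : ZMod 23) = r at h1
    revert r
    decide
  intro h
  rw [cyclicTheta_eq, h3, h4] at h
  obtain ⟨h0, h1, h2⟩ | ⟨h0, h1, h2⟩ | ⟨h0, h1, h2⟩ | ⟨h0, h1, h2⟩ | ⟨h0, h1, h2⟩ |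
    ⟨h0, h1, h2⟩ := perm_fix_three_four h3 h4 <;> rw [h0, h1, h2] at h <;> simp at h
  · exact hirr (20 * (m - (7140))) (by
      push_cast
      linear_combination 20 * h + 20 * ((132) + (-7) * α) * hα + (1613) * α * h23)
  · exact hirr (3 * (m - (-7700))) (by
      push_cast
      linear_combination 3 * h + 3 * ((188) + (7) * α) * hα + (-242) * α * h23)
  · exact hirr (3 * (m - (9349))) (by
      push_cast
      linear_combination 3 * h + 3 * ((113) + (-6) * α) * hα + (223) * α * h23)
  · exact hirr (3 * (m - (-17006))) (by
      push_cast
      linear_combination 3 * h + 3 * ((218) + (1) * α) * hα + (-8) * α * h23)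
  · exact hirr (20 * (m - (-16518))) (by
      push_cast
      linear_combination 20 * h + 20 * ((210) + (-1) * α) * hα + (53) * α * h23)
  · exact hirr (20 * (m - (-4331))) (by
      push_cast
      linear_combination 20 * h + 20 * ((161) + (6) * α) * hα + (-1487) * α * h23)

theorem quinticInt_map_charP {k : Type*} [Field k] [CharP k 23] :
    quinticInt.map (Int.castRingHom k) =
      (X ^ 2 + C 8 * X + C 19) * (X - C 6) * (X - C 12) * (X - C 13) := by
  have h23 : (23 : k[X]) = 0 := CharP.cast_eq_zero k[X] 23
  rw [quinticInt_map]
  simp only [map_ofNat]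
  -- The bracket is the difference of the two sides over `ℤ`, divided by 23.
  linear_combination ((780) + (658) * X + (-37) * X ^ 2 + (13) * X ^ 3 + (1) * X ^ 4) * h23

/-- Lying over: some maximal ideal of `A` contracts to `(p)`. Applied to the ring of all algebraic
integers, it reduces all roots at once. -/
theorem exists_charP_quotient (A : Type*) [CommRing A] [Algebra.IsIntegral ℤ A]
    [CharZero A] (p : ℕ) [hp : Fact p.Prime] :
    ∃ M : Ideal A, M.IsMaximal ∧ CharP (A ⧸ M) p := by
  have hm : (Ideal.span {(p : ℤ)}).IsMaximal :=
    Int.ideal_span_isMaximal_of_prime p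
  obtain ⟨M, hM, hcomap⟩ := Ideal.exists_ideal_over_maximal_of_isIntegral (S := A)
    (Ideal.span {(p : ℤ)}) (by
      rw [(RingHom.injective_iff_ker_eq_bot _).1 (algebraMap ℤ A).injective_int]
      exact bot_le)
  refine ⟨M, hM, ?_⟩
  have hpM : ((p : ℕ) : A ⧸ M) = 0 := by
    rw [← map_natCast (Ideal.Quotient.mk M), Ideal.Quotient.eq_zero_iff_mem]
    have : (p : ℤ) ∈ M.comap (algebraMap ℤ A) := hcomap ▸ Ideal.mem_span_singleton_self _
    simpa using this
  have : (M.IsMaximal) := hM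
  have : Nontrivial (A ⧸ M) := Ideal.Quotient.nontrivial_iff.2 hM.ne_top
  exact (CharP.charP_iff_prime_eq_zero hp.out).2 hpM

theorem not_isRoot_of_map_eq_sexticProd {R : ℚ[X]}
    (hR : ∀ x : Fin 5 → ℂ, quintic.map (algebraMap ℚ ℂ) = ∏ i, (X - C (x i)) →
      R.map (algebraMap ℚ ℂ) = sexticProd x) (q : ℚ) : ¬ R.IsRoot q := by
  intro hq
  have : Fact (Nat.Prime 23) := ⟨by norm_num⟩
  let A := integralClosure ℤ ℂ
  obtain ⟨M, hM, hchar⟩ := exists_charP_quotient A 23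
  let := Ideal.Quotient.field M
  let r : A →+* A ⧸ M := Ideal.Quotient.mk M
  have hinj : Function.Injective (algebraMap A ℂ) := Subtype.val_injective
  obtain ⟨z, hz⟩ := exists_eq_prod_X_sub_C (IsAlgClosed.splits (quinticInt.map (Int.castRingHom ℂ)))
    (quinticInt_monic.map _) ((quinticInt_monic.natDegree_map _).trans quinticInt_natDegree)
  have hzi (i : Fin 5) : IsIntegral ℤ (z i) := by
    refine ⟨quinticInt, quinticInt_monic, ?_⟩
    change eval₂ (Int.castRingHom ℂ) (z i) quinticInt = 0
    rw [← eval_map, hz, eval_prod]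
    exact Finset.prod_eq_zero (Finset.mem_univ i) (by simp)
  let x : Fin 5 → A := fun i => ⟨z i, hzi i⟩
  have hx : quinticInt.map (Int.castRingHom A) = ∏ i, (X - C (x i)) := by
    apply map_injective (algebraMap A ℂ) hinj
    rw [Polynomial.map_map, RingHom.ext_int ((algebraMap A ℂ).comp (Int.castRingHom A))
      (Int.castRingHom ℂ), hz, Polynomial.map_prod]
    simp only [Polynomial.map_sub, map_X, map_C]
    rfl
  have hxr : quinticInt.map (Int.castRingHom (A ⧸ M)) = ∏ i, (X - C (r (x i))) := by
    rw [RingHom.ext_int (Int.castRingHom (A ⧸ M)) (r.comp (Int.castRingHom A)),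
      ← Polynomial.map_map, hx, Polynomial.map_prod]
    simp only [Polynomial.map_sub, map_X, map_C]
  obtain ⟨α, hα⟩ : ∃ α : A ⧸ M, α ^ 2 + 8 * α + 19 = 0 := by
    have hd : (X ^ 2 + C 8 * X + C 19 : (A ⧸ M)[X]).degree = 2 := by compute_degree!
    have hs : (quinticInt.map (Int.castRingHom (A ⧸ M))).Splits :=
      hxr ▸ Splits.prod fun i _ => Splits.X_sub_C _
    have hdvd : (X ^ 2 + C 8 * X + C 19) ∣ quinticInt.map (Int.castRingHom (A ⧸ M)) := by
      rw [quinticInt_map_charP, mul_assoc, mul_assoc]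
      exact dvd_mul_right _ _
    obtain ⟨α, hα⟩ := (hs.of_dvd (quinticInt_monic.map _).ne_zero hdvd).exists_eval_eq_zero (hd ▸ two_ne_zero)
    exact ⟨α, by simpa using hα⟩
  -- Relabelling the roots to match their reductions is harmless, since `hR` holds for every
  -- labelling.
  obtain ⟨τ, hτ⟩ : ∃ τ : Equiv.Perm (Fin 5), ∀ i, r (x (τ i)) = ![α, -8 - α, 6, 12, 13] i := by
    refine exists_perm_of_prod_X_sub_C_eq (x := fun i => r (x i)) ?_
    rw [← hxr, quinticInt_map_charP, Fin.prod_univ_five]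
    have hq : (X ^ 2 + C 8 * X + C 19 : (A ⧸ M)[X]) = (X - C α) * (X - C (-8 - α)) := by
      have := congrArg C hα
      simp only [C_add, C_mul, C_pow, C_sub, C_neg, C_0] at this ⊢
      linear_combination this
    rw [hq]
    rfl
  have hzτ : quintic.map (algebraMap ℚ ℂ) = ∏ i, (X - C (z (τ i))) := by
    rw [← quinticInt_map_rat, Polynomial.map_map, RingHom.ext_int
      ((algebraMap ℚ ℂ).comp (Int.castRingHom ℚ)) (Int.castRingHom ℂ), hz]
    exact (Equiv.prod_comp τ fun i => X - C (z i)).symm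
  have hq' := congrArg (eval (q : ℂ)) (hR _ hzτ)
  rw [show (q : ℂ) = algebraMap ℚ ℂ q from rfl, eval_map_apply, hq.eq_zero, map_zero, sexticProd,
    eval_prod, eq_comm, Finset.prod_eq_zero_iff] at hq'
  obtain ⟨σ, hσ, hσq⟩ := hq'
  obtain ⟨h3, h4⟩ := (Finset.mem_filter.1 hσ).2
  rw [eval_sub, eval_X, eval_C, sub_eq_zero] at hσq
  have hθ : algebraMap A ℂ (cyclicTheta fun i => x (τ (σ i))) = algebraMap ℚ ℂ q := by
    rw [hσq, map_cyclicTheta]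
    rfl
  -- `q` is a polynomial in algebraic integers, hence integral, hence an integer.
  obtain ⟨m, hm⟩ : ∃ m : ℤ, (m : ℚ) = q := by
    have : IsIntegral ℤ (algebraMap ℚ ℂ q) := hθ ▸ (cyclicTheta fun i => x (τ (σ i))).2
    exact IsIntegrallyClosed.isIntegral_iff.1
      ((isIntegral_algebraMap_iff (algebraMap ℚ ℂ).injective).1 this)
  refine cyclicTheta_ne_intCast_of_charP hα h3 h4 m ?_
  have hmθ : (m : A) = cyclicTheta fun i => x (τ (σ i)) := hinj (by rw [hθ, ← hm]; simp)
  rw [← map_intCast r, hmθ, map_cyclicTheta]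
  simp only [hτ]

/-! ### Galois descent for the sextic and for `θ`. -/

theorem map_eq_prod_X_sub_C_of_equiv_rootSet {F : Type*} [Field F] {f : F[X]} (hm : f.Monic)
    (hsep : f.Separable) {ι : Type*} [Fintype ι] (e : ι ≃ f.rootSet f.SplittingField) :
    f.map (algebraMap F f.SplittingField) = ∏ i, (X - C (e i : f.SplittingField)) := by
  classical
  have hnd : (f.map (algebraMap F f.SplittingField)).roots.Nodup := nodup_roots hsep.map
  conv_lhs => rw [(SplittingField.splits f).eq_prod_roots_of_monic (hm.map _)]
  rw [Equiv.prod_comp e fun r => X - C (r : f.SplittingField)]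
  rw [← Finset.prod_subtype (aroots f f.SplittingField).toFinset
    (fun r => by rw [rootSet, Finset.mem_coe]) fun r => X - C r]
  rw [Finset.prod, Multiset.toFinset_val, aroots, hnd.dedup]

theorem map_eq_prod_of_algHom {F K L : Type*} [Field F] [Field K] [Field L] [Algebra F K]
    [Algebra F L] (φ : K →ₐ[F] L) {f : F[X]} {ι : Type*} [Fintype ι] {x : ι → K}
    (h : f.map (algebraMap F K) = ∏ i, (X - C (x i))) :
    f.map (algebraMap F L) = ∏ i, (X - C (φ (x i))) := by
  rw [← φ.comp_algebraMap, ← Polynomial.map_map, h, Polynomial.map_prod]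
  simp

/-- Galois automorphisms permute the roots and the sextic is symmetric in them, so its coefficients
are fixed and lie in `F`. The same symmetry makes the result independent of the labelling. -/
theorem exists_map_eq_sexticProd {F : Type*} [Field F] {f : F[X]} (hm : f.Monic)
    (hsep : f.Separable) (hd : f.natDegree = 5) (K : Type*) [Field K] [IsAlgClosed K]
    [Algebra F K] : ∃ R : F[X], ∀ x : Fin 5 → K,
      f.map (algebraMap F K) = ∏ i, (X - C (x i)) → R.map (algebraMap F K) = sexticProd x := by
  obtain ⟨y, hy⟩ := exists_eq_prod_X_sub_C (SplittingField.splits f) (hm.map _)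
    ((hm.natDegree_map _).trans hd)
  have : IsGalois F f.SplittingField := IsGalois.of_separable_splitting_field hsep
  have hlift : sexticProd y ∈ lifts (algebraMap F f.SplittingField) := by
    rw [lifts_iff_coeff_lifts]
    intro n
    rw [IsGalois.mem_range_algebraMap_iff_fixed]
    intro g
    obtain ⟨τ, hτ⟩ : ∃ τ : Equiv.Perm (Fin 5), ∀ i, y (τ i) = g (y i) :=
      exists_perm_of_prod_X_sub_C_eq (hy.symm.trans (map_eq_prod_of_algHom g.toAlgHom hy))
    have h := map_sexticProd (g : f.SplittingField →+* f.SplittingField) y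
    have h2 := sexticProd_comp_perm y τ
    simp only [hτ] at h2
    conv_rhs => rw [← h2]
    exact (coeff_map _ n).symm.trans (congrArg (coeff · n) h)
  obtain ⟨R, hR⟩ := (mem_lifts _).1 hlift
  let φ : f.SplittingField →ₐ[F] K := SplittingField.lift f (IsAlgClosed.splits _)
  refine ⟨R, fun x hx => ?_⟩
  have hRφ : R.map (algebraMap F K) = sexticProd fun i => φ (y i) := by
    have := map_sexticProd (φ : f.SplittingField →+* K) y
    rw [← hR, Polynomial.map_map, AlgHom.comp_algebraMap] at this
    exact this
  obtain ⟨τ, hτ⟩ : ∃ τ : Equiv.Perm (Fin 5), ∀ i, φ (y (τ i)) = x i :=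
    exists_perm_of_prod_X_sub_C_eq (x := fun i => φ (y i))
      ((map_eq_prod_of_algHom φ hy).symm.trans hx)
  rw [hRφ, ← sexticProd_comp_perm _ τ]
  simp only [hτ]

/-- In the affine labelling of the roots every automorphism fixes `θ`, which therefore lies in the
base field. -/
theorem exists_cyclicTheta_eq_of_isSolvable_gal {F : Type*} [Field F] {f : F[X]} (hm : f.Monic)
    (hirr : Irreducible f) (hsep : f.Separable) (hd : f.natDegree = 5) (hG : Group.IsSolvable f.Gal)
    (K : Type*) [Field K] [IsAlgClosed K] [Algebra F K] : ∃ x : Fin 5 → K,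
      f.map (algebraMap F K) = ∏ i, (X - C (x i)) ∧ ∃ q : F, algebraMap F K q = cyclicTheta x := by
  have : IsGalois F f.SplittingField := IsGalois.of_separable_splitting_field hsep
  have : Fact (Nat.Prime 5) := ⟨by norm_num⟩
  have hcard : Nat.card (f.rootSet f.SplittingField) = 5 := by
    rw [Nat.card_eq_fintype_card, card_rootSet_eq_natDegree hsep (SplittingField.splits f), hd]
  have : FaithfulSMul f.Gal (f.rootSet f.SplittingField) :=
    ⟨fun {_ _} H => Gal.ext _ fun r hr => congrArg Subtype.val (H ⟨r, hr⟩)⟩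
  have : MulAction.IsPretransitive f.Gal (f.rootSet f.SplittingField) := by
    refine ⟨fun x y => ?_⟩
    have hx := minpoly.eq_of_irreducible hirr (mem_rootSet.1 x.2).2
    have hy := minpoly.eq_of_irreducible hirr (mem_rootSet.1 y.2).2
    obtain ⟨g, hg⟩ := (Normal.minpoly_eq_iff_mem_orbit f.SplittingField).1 (hy.symm.trans hx)
    exact ⟨g, Subtype.ext hg⟩
  obtain ⟨e, he⟩ := exists_equiv_smul_eq_affine (p := 5) hcard hG
  -- `ZMod 5` unfolds to `Fin 5`, the index type of `cyclicTheta`.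
  change Fin 5 ≃ _ at e
  change ∀ g : f.Gal, ∃ a b : Fin 5, ∀ i : Fin 5, g • e i = e (a * i + b) at he
  have hfix (g : f.Gal) : g (cyclicTheta fun i => (e i : f.SplittingField)) =
      cyclicTheta fun i => (e i : f.SplittingField) := by
    obtain ⟨a, b, hab⟩ := he g
    -- With `a = 0` the automorphism would send two distinct roots to the same one.
    have ha : a ≠ 0 := by
      rintro rfl
      have h0 := hab 0
      have h1 := hab 1
      rw [Fin.zero_mul] at h0 h1
      exact absurd (e.injective (MulAction.injective g (h0.trans h1.symm))) (by decide)
    refine (map_cyclicTheta (g : f.SplittingField →+* f.SplittingField) _).trans ?_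
    rw [← cyclicTheta_affine (fun i => (e i : f.SplittingField)) ha b]
    congr 1
    ext i
    exact congrArg Subtype.val (hab i)
  obtain ⟨q, hq⟩ := (IsGalois.mem_range_algebraMap_iff_fixed _).2 hfix
  let φ : f.SplittingField →ₐ[F] K := SplittingField.lift f (IsAlgClosed.splits _)
  refine ⟨fun i => φ (e i), map_eq_prod_of_algHom φ (map_eq_prod_X_sub_C_of_equiv_rootSet hm hsep e),
    q, ?_⟩
  rw [← φ.commutes, hq]
  exact map_cyclicTheta (φ : f.SplittingField →+* K) _

/-! ### Insolvability of the quintic and conclusion. -/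

theorem exists_map_quintic_eq_sexticProd : ∃ R : ℚ[X], ∀ x : Fin 5 → ℂ,
    quintic.map (algebraMap ℚ ℂ) = ∏ i, (X - C (x i)) → R.map (algebraMap ℚ ℂ) = sexticProd x :=
  exists_map_eq_sexticProd quintic_monic quintic_irreducible.separable quintic_natDegree ℂ

theorem quintic_gal_not_isSolvable : ¬ Group.IsSolvable quintic.Gal := by
  intro hG
  obtain ⟨R, hR⟩ := exists_map_quintic_eq_sexticProd
  obtain ⟨x, hx, q, hq⟩ := exists_cyclicTheta_eq_of_isSolvable_gal quintic_monic quintic_irreducible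
    quintic_irreducible.separable quintic_natDegree hG ℂ
  refine not_isRoot_of_map_eq_sexticProd hR q ?_
  have h := congrArg (eval (algebraMap ℚ ℂ q)) (hR _ hx)
  -- The factor at the identity permutation vanishes at `q = θ`, contradicting the absence of
  -- rational roots.
  rw [eval_map_apply, sexticProd, eval_prod, Finset.prod_eq_zero (i := 1) (by simp)] at h
  · exact (algebraMap ℚ ℂ).injective (h.trans (map_zero _).symm)
  · rw [eval_sub, eval_X, eval_C, sub_eq_zero, hq]
    rfl

theorem quintic_root_notMem_solvableByRad {z : ℂ} (hz : aeval z quintic = 0) :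
    z ∉ solvableByRad ℚ ℂ := fun h =>
  quintic_gal_not_isSolvable (isSolvable_gal_of_irreducible h quintic_irreducible hz)

theorem IsDataAverage.six_data_notMem_solvableByRad {a : ℝ} (h : IsDataAverage 6 data a) :
    (a : ℂ) ∉ solvableByRad ℚ ℂ := by
  intro ha
  refine quintic_root_notMem_solvableByRad (z := ((a - 10 : ℝ) : ℂ)) ?_ ?_
  · rw [show ((a - 10 : ℝ) : ℂ) = algebraMap ℝ ℂ (a - 10) from rfl, aeval_algebraMap_apply,
      h.six_data.2, map_zero]
  · rw [Complex.ofReal_sub, Complex.ofReal_ofNat]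
    exact sub_mem ha (ofNat_mem _ 10)

theorem mainTheorem10 :
    -- the 6-average `a` of the data exists and is unique; it solves the quintic equation
    -- `∑ (a - xᵢ)⁵ = 0`, `a - 10` is a root of the depressed quintic, and `a` is not
    -- expressible by radicals over `ℚ`
    (∃! a : ℝ, IsDataAverage 6 data a) ∧
    (∀ a : ℝ, IsDataAverage 6 data a →
      (a - 1) ^ 5 + (a - 6) ^ 5 + (a - 11) ^ 5 + (a - 13) ^ 5 + (a - 19) ^ 5 = 0 ∧
      aeval (a - 10) quintic = 0 ∧
      (a : ℂ) ∉ solvableByRad ℚ ℂ) ∧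
    -- the quintic is irreducible, its resolvent sextic has no rational root, and none of its
    -- complex roots is expressible by radicals
    Irreducible quintic ∧
    (∃ R : ℚ[X], IsResolventSextic quintic R ∧ ∀ q : ℚ, ¬ R.IsRoot q) ∧
    (∀ z : ℂ, aeval z quintic = 0 → z ∉ solvableByRad ℚ ℂ) ∧
    -- no radical formula gives the 6-average of all lists of five real numbers
    (¬ ∃ F : RadicalFormula 5, ∀ (x : Fin 5 → ℝ) (a : ℝ),
      IsDataAverage 6 x a → F.IsValue (fun i => (x i : ℂ)) (a : ℂ)) ∧
    -- the 4-average of `n` real numbers is given by a radical formula, for every `n ≥ 1`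
    (∀ n : ℕ, 0 < n → ∃ F : RadicalFormula n, ∀ (x : Fin n → ℝ) (a : ℝ),
      IsDataAverage 4 x a → F.IsRealValue x a) := by
  refine ⟨existsUnique_isDataAverage_six_data,
    fun a ha => ⟨ha.six_data.1, ha.six_data.2, ha.six_data_notMem_solvableByRad⟩,
    quintic_irreducible, ?_, fun z hz => quintic_root_notMem_solvableByRad hz, ?_,
    fun n hn => ⟨RadicalFormula.fourAverage n, fun x a => RadicalFormula.isRealValue_fourAverage hn⟩⟩
  · obtain ⟨R, hR⟩ := exists_map_quintic_eq_sexticProd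
    exact ⟨R, ⟨quintic_monic, quintic_natDegree, hR⟩, not_isRoot_of_map_eq_sexticProd hR⟩
  · rintro ⟨F, hF⟩
    obtain ⟨a, ha, -⟩ := existsUnique_isDataAverage_six_data
    -- At rational arguments every value of a radical formula lies in `solvableByRad ℚ ℂ`, whatever
    -- complex roots are chosen.
    refine ha.six_data_notMem_solvableByRad
      (RadicalFormula.IsValue.mem_solvableByRad (fun i => ?_) (hF data a ha))
    fin_cases i <;> simp [data, ofNat_mem]
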